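/- Fix an odd natural number $a$. For $n\ge 1$ let $U_1,\dots,U_n$ be independent random variables, each uniformly distributed on $[0,1]$ (the initial positions of $n$ sensors), and let $X_1\le X_2\le\dots\le X_n$ be their order statistics, i.e. $X_i$ is the $i$-th smallest of $U_1,\dots,U_n$. Then $$\sum_{i=1}^n \mathbf{E}\left[\left|X_i-\left(\frac{i}{n}-\frac{1}{2n}\right)\right|^a\right]=\frac{\Gamma\left(\frac a2+1\right)}{2^{a/2}(1+a)}\,\frac{1}{n^{\frac a2-1}}+O\left(\frac{1}{n^{\frac{a-1}{2}}}\right)\qquad(n\to\infty),$$ where $\Gamma$ is the Gamma function and the constant implied by $O$ depends only on $a$. -/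

import Mathlib

open MeasureTheory ProbabilityTheory

/-- The `i`-th order statistic of the family `U`: the `i`-th entry (counted from `0`) of
`U 0 ω, …, U (n - 1) ω` rearranged in nondecreasing order. -/
noncomputable def orderStat {Ω : Type*} {n : ℕ} (U : Fin n → Ω → ℝ) (i : Fin n) (ω : Ω) : ℝ :=
  U (Tuple.sort (fun j => U j ω) i) ω

/-- The anchor points `1 / (2n), 3 / (2n), …`. The index `i : Fin n` is counted from `0`, so the
anchor of the sensor with `1`-based index `k = i + 1` is `k / n - 1 / (2n)`. -/
noncomputable def anchor (n : ℕ) (i : Fin n) : ℝ :=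
  (((i : ℕ) + 1 : ℕ) : ℝ) / n - 1 / (2 * n)

/-!
Write `N(x)` for the number of sample points in `(-∞, x]`. Up to the discretization of `[0, 1]`
into the cells `[i / n, (i + 1) / n]`, on which the empirical quantile function is the constant
`orderStat U i`, the sum in question is `n` times the `a`-th power of the distance between the
quantile function and the identity. For the uniform distribution that distance has an exact
expression through the distribution function,
`∑ i, ∫ u in i/n..(i+1)/n, |X i - u| ^ a = ∫ x in 0..1, |N(x) / n - x| ^ a`
(`sum_integral_orderStat_eq`), so no quantile has to be analysed: `N(x)` is binomial
(`integral_sampleCount`), and everything is reduced to the integrated absolute central moments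
`absMoment n a 0` of the binomial distribution. Replacing each cell by its midpoint costs a moment
of order `a - 1` (`abs_sum_integral_sub_absMoment_le`), which has the order of the error term.

The binomial weights satisfy `x (1 - x) p' = (k - n x) p`. Integrating by parts over `x ∈ [0, 1]`
therefore lowers the order of the moment by two at the price of a factor `n x (1 - x)` and of an
error of order one less (`abs_absMoment_sub_le`). Even moments are bounded in this way
(`exists_absMoment_even_le`), and odd moments are reduced to the first one. There the sign change
of `k - n x` at `x = k / n` produces the boundary terms
`2 (u (1 - u)) ^ (j + 1) p(u)` with `u = k / n`, which Stirling's formula turns into a Riemann sum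
of `(u (1 - u)) ^ (j + 1 / 2)` (`exists_absMoment_one_sub_le`). The resulting Beta integral is
evaluated with the duplication formula (`moment_constant_eq`).
-/

/-! ### Binomial weights and their weighted absolute moments -/

/-- The probability that a binomial variable with parameters `n` and `x` takes the value `k`. -/
noncomputable def binomWeight (n k : ℕ) (x : ℝ) : ℝ :=
  n.choose k * x ^ k * (1 - x) ^ (n - k)

/-- The `b`-th absolute central moment of a binomial variable with parameters `n` and `x`,
integrated over `x ∈ [0, 1]` against the weight `(x (1 - x)) ^ j`. -/
noncomputable def absMoment (n b j : ℕ) : ℝ :=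
  ∑ k ∈ Finset.range (n + 1),
    ∫ x in (0 : ℝ)..1, (x * (1 - x)) ^ j * binomWeight n k x * |(k : ℝ) - n * x| ^ b

lemma continuous_binomWeight (n k : ℕ) : Continuous (binomWeight n k) := by
  unfold binomWeight; fun_prop

lemma binomWeight_nonneg (n k : ℕ) {x : ℝ} (hx : x ∈ Set.Icc (0 : ℝ) 1) :
    0 ≤ binomWeight n k x := by
  have h0 := hx.1
  have h1 : 0 ≤ 1 - x := sub_nonneg.2 hx.2
  unfold binomWeight; positivity

lemma sum_binomWeight (n : ℕ) (x : ℝ) :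
    ∑ k ∈ Finset.range (n + 1), binomWeight n k x = 1 := by
  have h := add_pow x (1 - x) n
  simp only [add_sub_cancel, one_pow] at h
  rw [h]
  refine Finset.sum_congr rfl fun k _ => ?_
  unfold binomWeight; ring

lemma mul_one_sub_mem {x : ℝ} (hx : x ∈ Set.Icc (0 : ℝ) 1) :
    0 ≤ x * (1 - x) ∧ x * (1 - x) ≤ 1 := by
  obtain ⟨h0, h1⟩ := hx
  constructor <;> nlinarith

/-- The binomial weights satisfy `x (1 - x) p' = (k - n x) p`; this is that identity after
multiplication by a power of `x (1 - x)`. -/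
lemma hasDerivAt_weight_mul_binomWeight {n k : ℕ} (hk : k ≤ n) (j : ℕ) (x : ℝ) :
    HasDerivAt (fun x => (x * (1 - x)) ^ (j + 1) * binomWeight n k x)
      ((j + 1) * ((x * (1 - x)) ^ j * (1 - 2 * x) * binomWeight n k x)
        + (x * (1 - x)) ^ j * binomWeight n k x * (k - n * x)) x := by
  have h1 : HasDerivAt (fun x : ℝ => x ^ (k + j + 1)) ((k + j + 1 : ℕ) * x ^ (k + j)) x := by
    simpa using hasDerivAt_pow (k + j + 1) x
  have h2 : HasDerivAt (fun x : ℝ => (1 - x) ^ (n - k + j + 1))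
      ((n - k + j + 1 : ℕ) * (1 - x) ^ (n - k + j) * (-1)) x := by
    have h := ((hasDerivAt_id x).const_sub 1).pow (n - k + j + 1)
    simp only [Nat.add_sub_cancel] at h
    exact h
  have h3 := (h1.mul h2).const_mul (n.choose k : ℝ)
  convert! h3 using 1
  · funext y
    simp only [binomWeight, Pi.mul_apply, mul_pow]
    ring
  · have : ((n - k + j + 1 : ℕ) : ℝ) = n - k + j + 1 := by
      push_cast [Nat.cast_sub hk]; ring
    rw [this]
    simp only [binomWeight, mul_pow]
    push_cast
    ring

lemma hasDerivAt_mul_abs_pow (p : ℕ) (y : ℝ) :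
    HasDerivAt (fun y : ℝ => y * |y| ^ p) ((p + 1) * |y| ^ p) y := by
  rcases lt_trichotomy y 0 with h | rfl | h
  · have h1 := (hasDerivAt_id y).mul ((hasDerivAt_abs_neg h).pow p)
    convert! h1 using 1
    rcases p with _ | p
    · simp
    · simp [abs_of_neg h]; ring
  · rw [hasDerivAt_iff_tendsto_slope]
    have h1 : Filter.Tendsto (fun y : ℝ => |y| ^ p) (nhdsWithin 0 {0}ᶜ) (nhds (|0| ^ p)) :=
      (Continuous.tendsto (by fun_prop) 0).mono_left nhdsWithin_le_nhds
    have h2 : ((p : ℝ) + 1) * |(0 : ℝ)| ^ p = |0| ^ p := by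
      rcases p with _ | p <;> simp
    rw [h2]
    refine h1.congr' ?_
    filter_upwards [self_mem_nhdsWithin] with z hz
    have hz : z ≠ 0 := hz
    simp [slope_def_field]
    field_simp
  · have h1 := (hasDerivAt_id y).mul ((hasDerivAt_abs_pos h).pow p)
    convert! h1 using 1
    rcases p with _ | p
    · simp
    · simp [abs_of_pos h]; ring

/-- Integration by parts: the boundary terms vanish because of the weight `x (1 - x)`. -/
lemma integral_binomWeight_recurrence {n k : ℕ} (hk : k ≤ n) (b j : ℕ) :
    ∫ x in (0 : ℝ)..1, (x * (1 - x)) ^ j * binomWeight n k x * |(k : ℝ) - n * x| ^ (b + 2) =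
      n * (b + 1) *
        (∫ x in (0 : ℝ)..1, (x * (1 - x)) ^ (j + 1) * binomWeight n k x * |(k : ℝ) - n * x| ^ b) -
      (j + 1) * ∫ x in (0 : ℝ)..1, (x * (1 - x)) ^ j * (1 - 2 * x) * binomWeight n k x *
        ((k - n * x) * |(k : ℝ) - n * x| ^ b) := by
  have hc := continuous_binomWeight n k
  have hd : ∀ x : ℝ, HasDerivAt (fun x => ((x * (1 - x)) ^ (j + 1) * binomWeight n k x) *
        ((k - n * x) * |(k : ℝ) - n * x| ^ b))
      ((j + 1) * ((x * (1 - x)) ^ j * (1 - 2 * x) * binomWeight n k x *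
        ((k - n * x) * |(k : ℝ) - n * x| ^ b)) +
       (x * (1 - x)) ^ j * binomWeight n k x * |(k : ℝ) - n * x| ^ (b + 2) -
       n * (b + 1) * ((x * (1 - x)) ^ (j + 1) * binomWeight n k x * |(k : ℝ) - n * x| ^ b)) x := by
    intro x
    have h1 : HasDerivAt (fun x : ℝ => (k : ℝ) - n * x) (-n) x := by
      simpa using ((hasDerivAt_id x).const_mul (n : ℝ)).const_sub (k : ℝ)
    have h2 := (hasDerivAt_weight_mul_binomWeight hk j x).mul
      ((hasDerivAt_mul_abs_pow b ((k : ℝ) - n * x)).comp x h1)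
    convert! h2 using 1
    rw [pow_add, sq_abs]
    simp only [Function.comp]
    ring
  have h := intervalIntegral.integral_eq_sub_of_hasDerivAt (a := (0 : ℝ)) (b := 1)
    (fun x _ => hd x) (Continuous.intervalIntegrable (by fun_prop) _ _)
  rw [intervalIntegral.integral_sub, intervalIntegral.integral_add,
    intervalIntegral.integral_const_mul, intervalIntegral.integral_const_mul] at h
  · simp only [sub_self, mul_zero, zero_mul, zero_pow (Nat.succ_ne_zero j)] at h
    linarith
  all_goals exact Continuous.intervalIntegrable (by fun_prop) _ _

lemma absMoment_nonneg (n b j : ℕ) : 0 ≤ absMoment n b j := by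
  refine Finset.sum_nonneg fun k _ => intervalIntegral.integral_nonneg zero_le_one fun x hx => ?_
  have := binomWeight_nonneg n k hx
  have := (mul_one_sub_mem hx).1
  positivity

lemma absMoment_le (n b j : ℕ) : absMoment n b j ≤ absMoment n b 0 := by
  have hc := continuous_binomWeight n
  refine Finset.sum_le_sum fun k _ => intervalIntegral.integral_mono_on zero_le_one
    (Continuous.intervalIntegrable (by fun_prop) _ _)
    (Continuous.intervalIntegrable (by fun_prop) _ _) fun x hx => ?_
  have h1 := binomWeight_nonneg n k hx
  have h2 := mul_one_sub_mem hx
  have h3 : (x * (1 - x)) ^ j ≤ (x * (1 - x)) ^ 0 := by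
    rw [pow_zero]
    exact pow_le_one₀ h2.1 h2.2
  gcongr

lemma absMoment_zero_zero (n : ℕ) : absMoment n 0 0 = 1 := by
  have hc := continuous_binomWeight n
  unfold absMoment
  rw [← intervalIntegral.integral_finsetSum]
  · simp [sum_binomWeight]
  · exact fun k _ => Continuous.intervalIntegrable (by fun_prop) _ _

/-- A signed integrand bounded by the `b`-th absolute power contributes at most
`absMoment n b 0`. -/
lemma abs_sum_integral_le (n b j : ℕ) (s : ℕ → ℝ → ℝ)
    (hs : ∀ k x, |s k x| ≤ |(k : ℝ) - n * x| ^ b) :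
    |∑ k ∈ Finset.range (n + 1), ∫ x in (0 : ℝ)..1,
      (x * (1 - x)) ^ j * (1 - 2 * x) * binomWeight n k x * s k x| ≤ absMoment n b 0 := by
  have hc := continuous_binomWeight n
  refine (Finset.abs_sum_le_sum_abs _ _).trans (Finset.sum_le_sum fun k _ => ?_)
  rw [← Real.norm_eq_abs]
  refine intervalIntegral.norm_integral_le_of_norm_le zero_le_one ?_
    (Continuous.intervalIntegrable (by fun_prop) _ _)
  refine Filter.Eventually.of_forall fun x hx => ?_
  have hx' : x ∈ Set.Icc (0 : ℝ) 1 := ⟨hx.1.le, hx.2⟩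
  have h1 := binomWeight_nonneg n k hx'
  have h2 := mul_one_sub_mem hx'
  rw [norm_mul, norm_mul, norm_mul, norm_pow, Real.norm_of_nonneg h1, Real.norm_of_nonneg h2.1,
    Real.norm_eq_abs, Real.norm_eq_abs]
  have h3 : |1 - 2 * x| ≤ 1 := abs_le.2 ⟨by linarith [hx.2], by linarith [hx.1]⟩
  have h4 : (x * (1 - x)) ^ j * |1 - 2 * x| ≤ (x * (1 - x)) ^ 0 := by
    rw [pow_zero]
    exact mul_le_one₀ (pow_le_one₀ h2.1 h2.2) (abs_nonneg _) h3
  have := hs k x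
  gcongr

lemma abs_absMoment_sub_le (n b j : ℕ) :
    |absMoment n (b + 2) j - n * (b + 1) * absMoment n b (j + 1)| ≤
      (j + 1) * absMoment n (b + 1) 0 := by
  have h : absMoment n (b + 2) j - n * (b + 1) * absMoment n b (j + 1) =
      -((j + 1) * ∑ k ∈ Finset.range (n + 1), ∫ x in (0 : ℝ)..1,
        (x * (1 - x)) ^ j * (1 - 2 * x) * binomWeight n k x *
          ((k - n * x) * |(k : ℝ) - n * x| ^ b)) := by
    unfold absMoment
    rw [Finset.sum_congr rfl fun k hk => integral_binomWeight_recurrence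
      (Nat.lt_succ_iff.1 (Finset.mem_range.1 hk)) b j, Finset.sum_sub_distrib,
      ← Finset.mul_sum, ← Finset.mul_sum]
    ring
  rw [h, abs_neg, abs_mul, abs_of_nonneg (by positivity : (0 : ℝ) ≤ j + 1)]
  gcongr
  refine abs_sum_integral_le n (b + 1) j _ fun k x => ?_
  rw [abs_mul, abs_pow, abs_abs, pow_succ']

/-- Interpolation by `2 t ^ (b + 1) ≤ t ^ (b + 2) + t ^ b`, which absorbs the error term of the
recurrence for even moments. -/
lemma two_mul_absMoment_succ_le (n b : ℕ) :
    2 * absMoment n (b + 1) 0 ≤ absMoment n (b + 2) 0 + absMoment n b 0 := by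
  have hc := continuous_binomWeight n
  unfold absMoment
  rw [Finset.mul_sum, ← Finset.sum_add_distrib]
  refine Finset.sum_le_sum fun k _ => ?_
  rw [← intervalIntegral.integral_const_mul, ← intervalIntegral.integral_add
    (Continuous.intervalIntegrable (by fun_prop) _ _)
    (Continuous.intervalIntegrable (by fun_prop) _ _)]
  refine intervalIntegral.integral_mono_on zero_le_one
    (Continuous.intervalIntegrable (by fun_prop) _ _)
    (Continuous.intervalIntegrable (by fun_prop) _ _) fun x hx => ?_
  have h1 := binomWeight_nonneg n k hx
  have h2 : 0 ≤ binomWeight n k x * |(k : ℝ) - n * x| ^ b * (|(k : ℝ) - n * x| - 1) ^ 2 := by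
    positivity
  simp only [pow_zero, one_mul, pow_succ] at *
  nlinarith

/-- Even absolute moments of a binomial variable have the order of the matching power of the
variance. -/
lemma exists_absMoment_even_le (m : ℕ) :
    ∃ C : ℝ, 0 ≤ C ∧ ∀ n : ℕ, 1 ≤ n → absMoment n (2 * m) 0 ≤ C * (n : ℝ) ^ m := by
  induction m with
  | zero => exact ⟨1, zero_le_one, fun n _ => by simp [absMoment_zero_zero]⟩
  | succ m ih =>
    obtain ⟨C, hC, h⟩ := ih
    refine ⟨(2 * (2 * m + 1) + 1) * C, by positivity, fun n hn => ?_⟩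
    have h1 := (abs_le.1 (abs_absMoment_sub_le n (2 * m) 0)).2
    have h2 := two_mul_absMoment_succ_le n (2 * m)
    have h3 := absMoment_le n (2 * m) 1
    have hn' : (1 : ℝ) ≤ n := by exact_mod_cast hn
    have h4 : (n : ℝ) * ((2 * m : ℕ) + 1) * absMoment n (2 * m) 1 ≤
        n * ((2 * m : ℕ) + 1) * absMoment n (2 * m) 0 := by gcongr
    have h5 := absMoment_nonneg n (2 * m) 0
    have h6 : absMoment n (2 * (m + 1)) 0 ≤
        (2 * (2 * m + 1) + 1) * n * absMoment n (2 * m) 0 := by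
      rw [show 2 * (m + 1) = 2 * m + 2 by ring]
      push_cast at *
      nlinarith
    calc _ ≤ _ := h6
      _ ≤ (2 * (2 * m + 1) + 1) * n * (C * (n : ℝ) ^ m) := by gcongr; exact h n hn
      _ = _ := by ring

/-! ### Stirling's formula for the mode of the binomial distribution -/

/-- Summing the bounds for consecutive ratios gives the upper half of Stirling's formula with an
explicit relative error. -/
lemma stirlingSeq_le {k : ℕ} (hk : k ≠ 0) :
    Stirling.stirlingSeq k ≤ √Real.pi * Real.exp (1 / (12 * k)) := by
  obtain ⟨m, rfl⟩ := Nat.exists_eq_succ_of_ne_zero hk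
  let f : ℕ → ℝ := fun m => Real.log (Stirling.stirlingSeq (m + 1)) - 1 / (12 * ((m : ℝ) + 1))
  have hf : Monotone f := monotone_nat_of_le_succ fun p => by
    have h := Stirling.log_stirlingSeq_sdiff_le (p + 1)
    have h2 : 1 / (12 * ((p : ℝ) + 1)) - 1 / (12 * ((p : ℝ) + 1 + 1)) =
        1 / (12 * ((p : ℝ) + 1) * ((p : ℝ) + 1 + 1)) := by
      field_simp; ring
    simp only [f]
    push_cast at h ⊢
    linarith
  have hpi : 0 < √Real.pi := Real.sqrt_pos.2 Real.pi_pos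
  have hlim : Filter.Tendsto f Filter.atTop (nhds (Real.log √Real.pi - 0)) := by
    refine Filter.Tendsto.sub ?_ ?_
    · exact ((Real.continuousAt_log hpi.ne').tendsto.comp
        Stirling.tendsto_stirlingSeq_sqrt_pi).comp (Filter.tendsto_add_atTop_nat 1)
    · have := (tendsto_one_div_add_atTop_nhds_zero_nat (𝕜 := ℝ)).const_mul (1 / 12)
      simp only [mul_zero] at this
      refine this.congr fun p => ?_
      field_simp
  have h := hf.ge_of_tendsto hlim m
  have hS := Stirling.stirlingSeq'_pos m
  rw [← Real.log_le_log_iff hS (by positivity), Real.log_mul hpi.ne' (Real.exp_pos _).ne',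
    Real.log_exp]
  simp only [f] at h
  push_cast
  linarith

lemma binomWeight_eq_stirlingSeq {k l : ℕ} (hk : k ≠ 0) (hl : l ≠ 0) :
    √(2 * Real.pi * (k * l / (k + l))) * binomWeight (k + l) k (k / (k + l)) =
      √Real.pi * Stirling.stirlingSeq (k + l) /
        (Stirling.stirlingSeq k * Stirling.stirlingSeq l) := by
  have hk' : (0 : ℝ) < k := by positivity
  have hl' : (0 : ℝ) < l := by positivity
  have hfac : ∀ m : ℕ, m ≠ 0 → (m.factorial : ℝ) =
      Stirling.stirlingSeq m * (√(2 * m) * (m / Real.exp 1) ^ m) := fun m hm => by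
    unfold Stirling.stirlingSeq
    rw [div_mul_cancel₀]
    positivity
  have hSk : Stirling.stirlingSeq k ≠ 0 := by
    unfold Stirling.stirlingSeq; positivity
  have hSl : Stirling.stirlingSeq l ≠ 0 := by
    unfold Stirling.stirlingSeq; positivity
  have hsq : √(2 * Real.pi * (k * l / (k + l))) =
      √Real.pi * (√(2 * k) * √(2 * l) / √(2 * (k + l))) := by
    rw [← Real.sqrt_mul (by positivity), ← Real.sqrt_div (by positivity),
      ← Real.sqrt_mul (by positivity)]
    congr 1
    field_simp
  have h1 : (1 : ℝ) - k / (k + l) = l / (k + l) := by field_simp; ring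
  unfold binomWeight
  rw [Nat.add_sub_cancel_left, h1, Nat.cast_add_choose, hfac k hk, hfac l hl,
    hfac (k + l) (by omega), hsq]
  push_cast
  rw [div_pow, div_pow, div_pow, div_pow, div_pow, pow_add, pow_add]
  have e1 : √(2 * (k : ℝ)) ≠ 0 := by positivity
  have e2 : √(2 * (l : ℝ)) ≠ 0 := by positivity
  have e3 : √(2 * ((k : ℝ) + l)) ≠ 0 := by positivity
  field_simp

lemma binomWeight_stirling_bounds {k l : ℕ} (hk : k ≠ 0) (hl : l ≠ 0) :
    1 - (k + l : ℝ) / (k * l) ≤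
        √(2 * Real.pi * (k * l / (k + l))) * binomWeight (k + l) k (k / (k + l)) ∧
      √(2 * Real.pi * (k * l / (k + l))) * binomWeight (k + l) k (k / (k + l)) ≤ 1 := by
  have hk' : (0 : ℝ) < k := by positivity
  have hl' : (0 : ℝ) < l := by positivity
  have hpi : 0 < √Real.pi := Real.sqrt_pos.2 Real.pi_pos
  have hSk := Stirling.sqrt_pi_le_stirlingSeq hk
  have hSl := Stirling.sqrt_pi_le_stirlingSeq hl
  have hSn := Stirling.sqrt_pi_le_stirlingSeq (show k + l ≠ 0 by omega)
  have hSk0 := hpi.trans_le hSk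
  have hSl0 := hpi.trans_le hSl
  have hSn0 := hpi.trans_le hSn
  rw [binomWeight_eq_stirlingSeq hk hl]
  constructor
  · have hprod : Stirling.stirlingSeq k * Stirling.stirlingSeq l ≤
        (√Real.pi * Real.exp (1 / (12 * k))) * (√Real.pi * Real.exp (1 / (12 * l))) :=
      mul_le_mul (stirlingSeq_le hk) (stirlingSeq_le hl) hSl0.le (by positivity)
    have hexp : (1 - (k + l : ℝ) / (k * l)) *
        (Real.exp (1 / (12 * k)) * Real.exp (1 / (12 * l))) ≤ 1 := by
      rw [← Real.exp_add]
      have h1 := Real.one_sub_le_exp_neg ((k + l : ℝ) / (k * l))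
      have h2 : (1 : ℝ) / (12 * k) + 1 / (12 * l) ≤ (k + l) / (k * l) := by
        rw [div_add_div _ _ (by positivity) (by positivity),
          div_le_div_iff₀ (by positivity) (by positivity)]
        have : 0 < (k : ℝ) * l := by positivity
        nlinarith [mul_pos this hk', mul_pos this hl']
      calc _ ≤ Real.exp (-((k + l : ℝ) / (k * l))) *
            Real.exp (1 / (12 * k) + 1 / (12 * l)) := by gcongr
        _ = Real.exp (1 / (12 * k) + 1 / (12 * l) - (k + l : ℝ) / (k * l)) := by
            rw [← Real.exp_add]; congr 1; ring
        _ ≤ 1 := Real.exp_le_one_iff.2 (by linarith)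
    rw [le_div_iff₀ (by positivity)]
    rcases le_total (1 - (k + l : ℝ) / (k * l)) 0 with h0 | h0
    · have : 0 ≤ √Real.pi * Stirling.stirlingSeq (k + l) := by positivity
      have : (1 - (k + l : ℝ) / (k * l)) *
        (Stirling.stirlingSeq k * Stirling.stirlingSeq l) ≤ 0 :=
        mul_nonpos_of_nonpos_of_nonneg h0 (by positivity)
      linarith
    · calc _ ≤ (1 - (k + l : ℝ) / (k * l)) *
            ((√Real.pi * Real.exp (1 / (12 * k))) * (√Real.pi * Real.exp (1 / (12 * l)))) := by
            gcongr
        _ = √Real.pi * √Real.pi * ((1 - (k + l : ℝ) / (k * l)) *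
            (Real.exp (1 / (12 * k)) * Real.exp (1 / (12 * l)))) := by ring
        _ ≤ √Real.pi * √Real.pi * 1 := by gcongr
        _ ≤ _ := by rw [mul_one]; gcongr
  · rw [div_le_one (by positivity)]
    have hanti : Stirling.stirlingSeq (k + l) ≤ Stirling.stirlingSeq k := by
      obtain ⟨m, rfl⟩ := Nat.exists_eq_succ_of_ne_zero hk
      have := Stirling.stirlingSeq'_antitone (show m ≤ m + l by omega)
      simp only [Function.comp] at this
      rwa [show m.succ + l = (m + l).succ by omega]
    calc √Real.pi * Stirling.stirlingSeq (k + l) ≤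
        Stirling.stirlingSeq l * Stirling.stirlingSeq k := by gcongr
      _ = _ := mul_comm _ _

/-- At `u = k / n` the binomial weight is the Gaussian density `1 / √(2 π n u (1 - u))` up to a
relative error `1 / (n u (1 - u))`. -/
lemma abs_weight_mul_binomWeight_sub_le {n k : ℕ} (hk : k < n) (j : ℕ) :
    |2 * ((k / n : ℝ) * (1 - k / n)) ^ (j + 1) * binomWeight n k (k / n) -
      √(2 / (Real.pi * n)) * √(((k / n : ℝ) * (1 - k / n)) ^ (2 * j + 1))| ≤ 2 / n := by
  rcases Nat.eq_zero_or_pos k with rfl | hk0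
  · simp
    positivity
  obtain ⟨l, rfl⟩ := Nat.exists_eq_add_of_lt hk
  set l' := l + 1 with hl'
  have hl0 : l' ≠ 0 := by omega
  rw [show k + l + 1 = k + l' by omega]
  clear_value l'
  obtain ⟨h1, h2⟩ := binomWeight_stirling_bounds hk0.ne' hl0
  push_cast
  have hkp : (1 : ℝ) ≤ k := by exact_mod_cast hk0
  have hlp : (1 : ℝ) ≤ l' := by exact_mod_cast Nat.one_le_iff_ne_zero.2 hl0
  set p := binomWeight (k + l') k (k / (k + l'))
  set N : ℝ := k + l' with hN
  have hN0 : 0 < N := by positivity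
  set s : ℝ := (k / N) * (1 - k / N) with hs
  have hsN : N * s = k * l' / N := by
    rw [hs, hN]; field_simp; ring
  have hs0 : 0 < s := by
    have : 0 < N * s := by rw [hsN]; positivity
    exact (mul_pos_iff_of_pos_left hN0).1 this
  have hs1 : s ≤ 1 := (mul_one_sub_mem ⟨by positivity,
    (div_le_one hN0).2 (by rw [hN]; linarith)⟩).2
  have hsN2 : 1 / 2 ≤ N * s := by
    rw [hsN, div_le_div_iff₀ two_pos hN0, hN]; nlinarith
  have hinv : N / (k * l') = 1 / (N * s) := by rw [hsN, one_div_div]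
  rw [← hsN] at h1 h2
  rw [hinv] at h1
  set r := √(2 * Real.pi * (N * s)) * p with hr
  have hroot : √(s ^ (2 * j + 1)) = s ^ j * √s := by
    rw [pow_succ, Real.sqrt_mul (by positivity), mul_comm 2 j, pow_mul,
      Real.sqrt_sq (by positivity)]
  have hmain : 2 * s ^ (j + 1) * p = √(2 / (Real.pi * N)) * √(s ^ (2 * j + 1)) * r := by
    have e : √(2 / (Real.pi * N)) * √s * √(2 * Real.pi * (N * s)) = 2 * s := by
      rw [← Real.sqrt_mul (by positivity), ← Real.sqrt_mul (by positivity),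
        show 2 / (Real.pi * N) * s * (2 * Real.pi * (N * s)) = (2 * s) ^ 2 by
          have := Real.pi_pos.ne'
          field_simp, Real.sqrt_sq (by positivity)]
    rw [hr, hroot]
    linear_combination (-(s ^ j * p)) * e
  have hconst : √(2 / (Real.pi * N)) * √s * (1 / (N * s)) ≤ 2 / N := by
    rw [← Real.sqrt_mul (by positivity), ← Real.sqrt_sq (show 0 ≤ 1 / (N * s) by positivity),
      ← Real.sqrt_mul (by positivity)]
    refine Real.sqrt_le_iff.2 ⟨by positivity, ?_⟩
    have hpi : 1 ≤ Real.pi := by linarith [Real.pi_gt_three]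
    have e : 2 / (Real.pi * N) * s * (1 / (N * s)) ^ 2 = 2 / (Real.pi * (N * s) * N ^ 2) := by
      field_simp
    rw [e, div_pow, div_le_div_iff₀ (by positivity) (by positivity)]
    have h3 : 1 / 2 ≤ Real.pi * (N * s) := by nlinarith
    have : 0 < N ^ 2 := by positivity
    nlinarith
  rw [hmain, show √(2 / (Real.pi * N)) * √(s ^ (2 * j + 1)) * r -
    √(2 / (Real.pi * N)) * √(s ^ (2 * j + 1)) =
    -(√(2 / (Real.pi * N)) * √(s ^ (2 * j + 1)) * (1 - r)) by ring, abs_neg, abs_mul,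
    abs_of_nonneg (by positivity), abs_of_nonneg (by linarith : 0 ≤ 1 - r), hroot]
  calc √(2 / (Real.pi * N)) * (s ^ j * √s) * (1 - r)
      ≤ √(2 / (Real.pi * N)) * (1 * √s) * (1 / (N * s)) := by
        gcongr
        · exact pow_le_one₀ hs0.le hs1
        · linarith
    _ ≤ 2 / N := by rw [one_mul]; exact hconst

/-! ### A Riemann sum for a half-integer power of `x (1 - x)` -/

lemma abs_sqrt_sub_sqrt_le {a b : ℝ} (ha : 0 ≤ a) (hb : 0 ≤ b) : |√a - √b| ≤ √|a - b| := by
  have key : ∀ {a b : ℝ}, 0 ≤ a → a ≤ b → |√a - √b| ≤ √|a - b| := fun {a b} ha hab => by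
    rw [abs_sub_comm, abs_of_nonneg (sub_nonneg.2 (Real.sqrt_le_sqrt hab)), abs_sub_comm,
      abs_of_nonneg (sub_nonneg.2 hab), sub_le_iff_le_add]
    refine Real.sqrt_le_iff.2 ⟨by positivity, ?_⟩
    have h1 := Real.sq_sqrt (sub_nonneg.2 hab)
    have h2 := Real.sq_sqrt ha
    have := mul_nonneg (Real.sqrt_nonneg (b - a)) (Real.sqrt_nonneg a)
    nlinarith
  rcases le_total a b with h | h
  · exact key ha h
  · rw [abs_sub_comm, abs_sub_comm a]
    exact key hb h

lemma abs_sqrt_pow_sub_le (q : ℕ) {x y : ℝ} (hx : x ∈ Set.Icc (0 : ℝ) 1)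
    (hy : y ∈ Set.Icc (0 : ℝ) 1) :
    |√((x * (1 - x)) ^ q) - √((y * (1 - y)) ^ q)| ≤ √(q * |x - y|) := by
  have h1 := mul_one_sub_mem hx
  have h2 := mul_one_sub_mem hy
  refine (abs_sqrt_sub_sqrt_le (pow_nonneg h1.1 _) (pow_nonneg h2.1 _)).trans
    (Real.sqrt_le_sqrt ?_)
  refine (abs_pow_sub_pow_le ..).trans ?_
  have h3 : |x * (1 - x) - y * (1 - y)| ≤ |x - y| := by
    rw [show x * (1 - x) - y * (1 - y) = (x - y) * (1 - x - y) by ring, abs_mul]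
    exact mul_le_of_le_one_right (abs_nonneg _)
      (abs_le.2 ⟨by linarith [hx.2, hy.2], by linarith [hx.1, hy.1]⟩)
  have h4 : max |x * (1 - x)| |y * (1 - y)| ^ (q - 1) ≤ 1 := by
    refine pow_le_one₀ (by positivity) (max_le ?_ ?_)
    · rw [abs_of_nonneg h1.1]; exact h1.2
    · rw [abs_of_nonneg h2.1]; exact h2.2
  calc _ ≤ |x - y| * q * 1 := by gcongr
    _ = _ := by ring

/-- The Hölder exponent `1 / 2` of the integrand gives an error of order `√n`, which suffices. -/
lemma abs_riemannSum_sub_le {n : ℕ} (hn : 1 ≤ n) (q : ℕ) :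
    |∑ k ∈ Finset.range n, √(((k / n : ℝ) * (1 - k / n)) ^ q) -
      n * ∫ x in (0 : ℝ)..1, √((x * (1 - x)) ^ q)| ≤ √(q * n) := by
  have hn0 : (0 : ℝ) < n := by exact_mod_cast hn
  set f : ℝ → ℝ := fun x => √((x * (1 - x)) ^ q) with hf
  have hfc : Continuous f := by fun_prop
  have hsplit : ∫ x in (0 : ℝ)..1, f x =
      ∑ k ∈ Finset.range n, ∫ x in (k / n : ℝ)..((k + 1 : ℕ) / n : ℝ), f x := by
    have := intervalIntegral.sum_integral_adjacent_intervals (μ := volume) (f := f)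
      (a := fun k : ℕ => (k / n : ℝ)) (n := n)
      fun k _ => hfc.intervalIntegrable _ _
    rw [this]
    simp [hn0.ne']
  change |∑ k ∈ Finset.range n, f (k / n) - n * ∫ x in (0 : ℝ)..1, f x| ≤ _
  rw [hsplit, Finset.mul_sum, ← Finset.sum_sub_distrib]
  have hcell : ∀ k ∈ Finset.range n,
      |f (k / n) - n * ∫ x in (k / n : ℝ)..((k + 1 : ℕ) / n : ℝ), f x| ≤ √(q * (1 / n)) := by
    intro k hk
    have hk : k + 1 ≤ n := Finset.mem_range.1 hk
    have hk' : ((k + 1 : ℕ) : ℝ) ≤ n := by exact_mod_cast hk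
    have hlen : ((k + 1 : ℕ) / n : ℝ) - k / n = 1 / n := by push_cast; ring
    have hpos : (0 : ℝ) < 1 / n := by positivity
    have h1 : f (k / n) - n * ∫ x in (k / n : ℝ)..((k + 1 : ℕ) / n : ℝ), f x =
        n * ∫ x in (k / n : ℝ)..((k + 1 : ℕ) / n : ℝ), (f (k / n) - f x) := by
      rw [intervalIntegral.integral_sub (by simp) (hfc.intervalIntegrable _ _),
        intervalIntegral.integral_const, hlen, smul_eq_mul]
      field_simp
    have h0 : (0 : ℝ) ≤ k / n := by positivity
    have h1' : ((k + 1 : ℕ) / n : ℝ) ≤ 1 := (div_le_one hn0).2 hk'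
    have h2 : ‖∫ x in (k / n : ℝ)..((k + 1 : ℕ) / n : ℝ), (f (k / n) - f x)‖ ≤
        √(q * (1 / n)) * |((k + 1 : ℕ) / n : ℝ) - k / n| := by
      refine intervalIntegral.norm_integral_le_of_norm_le_const fun x hx => ?_
      rw [Set.uIoc_of_le (by linarith)] at hx
      refine (abs_sqrt_pow_sub_le q ⟨h0, by linarith⟩
        ⟨by linarith [hx.1], by linarith [hx.2]⟩).trans (Real.sqrt_le_sqrt ?_)
      gcongr
      rw [abs_le]
      constructor <;> linarith [hx.1, hx.2]
    rw [h1, abs_mul, abs_of_pos hn0]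
    rw [hlen, abs_of_pos hpos, Real.norm_eq_abs] at h2
    calc _ ≤ n * (√(q * (1 / n)) * (1 / n)) := by gcongr
      _ = _ := by field_simp
  calc _ ≤ ∑ k ∈ Finset.range n, √(q * (1 / n)) :=
        (Finset.abs_sum_le_sum_abs _ _).trans (Finset.sum_le_sum hcell)
    _ = n * √(q * (1 / n)) := by simp
    _ = √(q * n) := by
        rw [show (q * n : ℝ) = n ^ 2 * (q * (1 / n)) by field_simp,
          Real.sqrt_mul (sq_nonneg _), Real.sqrt_sq hn0.le]

/-! ### Asymptotics of the odd absolute moments -/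

/-- Integrating by parts separately on `[0, k / n]` and `[k / n, 1]`, where `k - n x` has constant
sign, leaves the boundary term at `k / n`. -/
lemma abs_integral_binomWeight_sub_le {n k : ℕ} (hn : 1 ≤ n) (hk : k ≤ n) (j : ℕ) :
    |(∫ x in (0 : ℝ)..1, (x * (1 - x)) ^ j * binomWeight n k x * |(k : ℝ) - n * x| ^ 1) -
      2 * ((k / n : ℝ) * (1 - k / n)) ^ (j + 1) * binomWeight n k (k / n)| ≤
      (j + 1) * ∫ x in (0 : ℝ)..1, (x * (1 - x)) ^ 0 * binomWeight n k x *
        |(k : ℝ) - n * x| ^ 0 := by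
  have hn0 : (0 : ℝ) < n := by exact_mod_cast hn
  have hc := continuous_binomWeight n k
  set u : ℝ := k / n with hu
  have hu0 : 0 ≤ u := by positivity
  have hu1 : u ≤ 1 := (div_le_one hn0).2 (by exact_mod_cast hk)
  have hnu : n * u = k := by rw [hu]; field_simp
  set A : ℝ → ℝ := fun x => (x * (1 - x)) ^ j * (1 - 2 * x) * binomWeight n k x with hA
  set B : ℝ → ℝ := fun x => (x * (1 - x)) ^ j * binomWeight n k x * (k - n * x) with hB
  have hAc : Continuous A := by fun_prop
  have hBc : Continuous B := by fun_prop
  have hparts : ∀ a b : ℝ, (j + 1) * (∫ x in a..b, A x) + ∫ x in a..b, B x =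
      (b * (1 - b)) ^ (j + 1) * binomWeight n k b -
        (a * (1 - a)) ^ (j + 1) * binomWeight n k a := fun a b => by
    have h := intervalIntegral.integral_eq_sub_of_hasDerivAt (a := a) (b := b)
      (fun x _ => hasDerivAt_weight_mul_binomWeight hk j x)
      (Continuous.intervalIntegrable (by fun_prop) _ _)
    rw [← h, intervalIntegral.integral_add (Continuous.intervalIntegrable (by fun_prop) _ _)
      (Continuous.intervalIntegrable (by fun_prop) _ _), intervalIntegral.integral_const_mul]
  have hleft : ∫ x in (0 : ℝ)..u, (x * (1 - x)) ^ j * binomWeight n k x * |(k : ℝ) - n * x| ^ 1 =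
      ∫ x in (0 : ℝ)..u, B x := by
    refine intervalIntegral.integral_congr fun x hx => ?_
    rw [Set.uIcc_of_le hu0] at hx
    have : 0 ≤ (k : ℝ) - n * x := by
      rw [← hnu]; nlinarith [hx.2]
    simp only [hB, pow_one, abs_of_nonneg this]
  have hright : ∫ x in u..1, (x * (1 - x)) ^ j * binomWeight n k x * |(k : ℝ) - n * x| ^ 1 =
      -∫ x in u..1, B x := by
    rw [← intervalIntegral.integral_neg]
    refine intervalIntegral.integral_congr fun x hx => ?_
    rw [Set.uIcc_of_le hu1] at hx
    have : (k : ℝ) - n * x ≤ 0 := by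
      rw [← hnu]; nlinarith [hx.1]
    simp only [hB, pow_one, abs_of_nonpos this]
    ring
  have hAle : ∀ x ∈ Set.Icc (0 : ℝ) 1, ‖A x‖ ≤
      (x * (1 - x)) ^ 0 * binomWeight n k x * |(k : ℝ) - n * x| ^ 0 := fun x hx => by
    have h1 := binomWeight_nonneg n k hx
    have h2 := mul_one_sub_mem hx
    have h3 : |1 - 2 * x| ≤ 1 := abs_le.2 ⟨by linarith [hx.2], by linarith [hx.1]⟩
    simp only [hA, norm_mul, norm_pow, Real.norm_of_nonneg h1, Real.norm_of_nonneg h2.1,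
      pow_zero, one_mul, mul_one]
    exact mul_le_of_le_one_left h1
      (mul_le_one₀ (pow_le_one₀ h2.1 h2.2) (norm_nonneg _) h3)
  have hint : ∀ a b : ℝ, IntervalIntegrable (fun x => (x * (1 - x)) ^ 0 * binomWeight n k x *
      |(k : ℝ) - n * x| ^ 0) volume a b :=
    fun a b => Continuous.intervalIntegrable (by fun_prop) _ _
  have h1 := intervalIntegral.norm_integral_le_of_norm_le (f := A) (μ := volume) hu0
    (Filter.Eventually.of_forall fun x hx => hAle x ⟨hx.1.le, hx.2.trans hu1⟩) (hint _ _)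
  have h2 := intervalIntegral.norm_integral_le_of_norm_le (f := A) (μ := volume) hu1
    (Filter.Eventually.of_forall fun x hx => hAle x ⟨hu0.trans hx.1.le, hx.2⟩) (hint _ _)
  have hI : ∀ a b : ℝ, IntervalIntegrable (fun x => (x * (1 - x)) ^ j * binomWeight n k x *
      |(k : ℝ) - n * x| ^ 1) volume a b :=
    fun a b => Continuous.intervalIntegrable (by fun_prop) _ _
  rw [← intervalIntegral.integral_add_adjacent_intervals (hI 0 u) (hI u 1),
    ← intervalIntegral.integral_add_adjacent_intervals (hint 0 u) (hint u 1), hleft, hright]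
  have p1 := hparts 0 u
  have p2 := hparts u 1
  simp only [sub_self, mul_zero, zero_mul, zero_pow (Nat.succ_ne_zero j)] at p1 p2
  have e : (∫ x in (0 : ℝ)..u, B x) + -(∫ x in u..1, B x) -
      2 * (u * (1 - u)) ^ (j + 1) * binomWeight n k u =
      (j + 1) * ((∫ x in u..1, A x) - ∫ x in (0 : ℝ)..u, A x) := by linarith
  rw [e, abs_mul, abs_of_nonneg (by positivity : (0 : ℝ) ≤ j + 1)]
  gcongr
  refine (abs_sub _ _).trans ?_
  rw [add_comm]
  exact add_le_add h1 h2

lemma exists_absMoment_one_sub_le (j : ℕ) :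
    ∃ C : ℝ, ∀ n : ℕ, 1 ≤ n →
      |absMoment n 1 j - √(2 / Real.pi) *
        (∫ x in (0 : ℝ)..1, √((x * (1 - x)) ^ (2 * j + 1))) * √n| ≤ C := by
  refine ⟨(j + 1) + (2 + √(2 * j + 1)), fun n hn => ?_⟩
  have hn0 : (0 : ℝ) < n := by exact_mod_cast hn
  set I := ∫ x in (0 : ℝ)..1, √((x * (1 - x)) ^ (2 * j + 1))
  set P := ∑ k ∈ Finset.range n, 2 * ((k / n : ℝ) * (1 - k / n)) ^ (j + 1) *
    binomWeight n k (k / n) with hP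
  set R := ∑ k ∈ Finset.range n, √(((k / n : ℝ) * (1 - k / n)) ^ (2 * j + 1)) with hR
  have h1 : |absMoment n 1 j - P| ≤ j + 1 := by
    have hP' : P = ∑ k ∈ Finset.range (n + 1), 2 * ((k / n : ℝ) * (1 - k / n)) ^ (j + 1) *
        binomWeight n k (k / n) := by
      rw [Finset.sum_range_succ, hP]
      simp [hn0.ne']
    have h := absMoment_zero_zero n
    unfold absMoment at h ⊢
    rw [hP', ← Finset.sum_sub_distrib]
    refine (Finset.abs_sum_le_sum_abs _ _).trans ((Finset.sum_le_sum fun k hk =>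
      abs_integral_binomWeight_sub_le hn (Nat.lt_succ_iff.1 (Finset.mem_range.1 hk)) j).trans ?_)
    rw [← Finset.mul_sum, h, mul_one]
  have h2 : |P - √(2 / (Real.pi * n)) * R| ≤ 2 := by
    rw [hP, hR, Finset.mul_sum, ← Finset.sum_sub_distrib]
    refine (Finset.abs_sum_le_sum_abs _ _).trans ((Finset.sum_le_sum fun k hk =>
      abs_weight_mul_binomWeight_sub_le (Finset.mem_range.1 hk) j).trans ?_)
    simp only [Finset.sum_const, Finset.card_range, nsmul_eq_mul]
    exact (mul_div_cancel₀ _ hn0.ne').le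
  have h3 : |√(2 / (Real.pi * n)) * R - √(2 / Real.pi) * I * √n| ≤ √(2 * j + 1) := by
    have e : √(2 / Real.pi) * √n = √(2 / (Real.pi * n)) * n := by
      rw [← Real.sqrt_mul (by positivity), ← Real.sqrt_sq hn0.le,
        ← Real.sqrt_mul (by positivity), Real.sqrt_sq hn0.le]
      congr 1
      field_simp
    rw [show √(2 / (Real.pi * n)) * R - √(2 / Real.pi) * I * √n =
      √(2 / (Real.pi * n)) * (R - n * I) by linear_combination (-I) * e, abs_mul,
      abs_of_nonneg (Real.sqrt_nonneg _)]
    refine (mul_le_mul_of_nonneg_left (abs_riemannSum_sub_le hn _) (Real.sqrt_nonneg _)).trans ?_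
    rw [← Real.sqrt_mul (by positivity)]
    refine Real.sqrt_le_sqrt ?_
    push_cast
    have : 2 / (Real.pi * n) * ((2 * j + 1) * n) = 2 / Real.pi * (2 * (j : ℝ) + 1) := by
      field_simp
    rw [this]
    exact mul_le_of_le_one_left (by positivity)
      ((div_le_one Real.pi_pos).2 (by linarith [Real.pi_gt_three]))
  refine (abs_sub_le _ P _).trans (add_le_add h1 ?_)
  exact (abs_sub_le _ _ _).trans (add_le_add h2 h3)

/-- The recurrence reduces an odd absolute moment to the first one, with errors controlled by even
moments. -/
lemma exists_absMoment_odd_sub_le (m : ℕ) : ∀ j : ℕ,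
    ∃ C : ℝ, ∀ n : ℕ, 1 ≤ n →
      |absMoment n (2 * m + 1) j - 2 ^ m * m.factorial * √(2 / Real.pi) *
        (∫ x in (0 : ℝ)..1, √((x * (1 - x)) ^ (2 * (m + j) + 1))) * (n ^ m * √n)| ≤
          C * (n : ℝ) ^ m := by
  induction m with
  | zero =>
    intro j
    obtain ⟨C, h⟩ := exists_absMoment_one_sub_le j
    exact ⟨C, fun n hn => by simpa using h n hn⟩
  | succ m ih =>
    intro j
    obtain ⟨C, h⟩ := ih (j + 1)
    obtain ⟨D, hD, hE⟩ := exists_absMoment_even_le (m + 1)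
    refine ⟨(j + 1) * D + (2 * m + 2) * C, fun n hn => ?_⟩
    have hn0 : (0 : ℝ) < n := by exact_mod_cast hn
    have h1 := abs_absMoment_sub_le n (2 * m + 1) j
    have h2 := h n hn
    have h3 := hE n hn
    rw [show m + (j + 1) = m + 1 + j by ring] at h2
    rw [show 2 * m + 1 + 1 = 2 * (m + 1) by ring,
      show 2 * m + 1 + 2 = 2 * (m + 1) + 1 by ring] at h1
    set I := ∫ x in (0 : ℝ)..1, √((x * (1 - x)) ^ (2 * (m + 1 + j) + 1))
    refine (abs_sub_le _ (n * (((2 * m + 1 : ℕ) : ℝ) + 1) * absMoment n (2 * m + 1) (j + 1))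
      _).trans ?_
    rw [add_mul]
    refine add_le_add (h1.trans ?_) ?_
    · rw [mul_assoc]; gcongr
    · rw [Nat.factorial_succ]
      push_cast
      rw [show (n : ℝ) * (2 * m + 1 + 1) * absMoment n (2 * m + 1) (j + 1) -
        2 ^ (m + 1) * ((m + 1) * m.factorial) * √(2 / Real.pi) * I * (n ^ (m + 1) * √n) =
        (n * (2 * m + 2)) * (absMoment n (2 * m + 1) (j + 1) -
          2 ^ m * m.factorial * √(2 / Real.pi) * I * (n ^ m * √n)) by ring, abs_mul,
        abs_of_nonneg (by positivity)]
      calc _ ≤ (n * (2 * m + 2)) * (C * (n : ℝ) ^ m) := by gcongr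
        _ = _ := by ring

/-! ### Evaluation of the constant -/

lemma integral_sqrt_pow_eq_beta (m : ℕ) :
    ∫ x in (0 : ℝ)..1, √((x * (1 - x)) ^ (2 * m + 1)) = beta (m + 3 / 2) (m + 3 / 2) := by
  rw [beta_eq_betaIntegralReal _ _ (by positivity) (by positivity), Complex.betaIntegral]
  rw [← Complex.ofReal_re (∫ x in (0 : ℝ)..1, √((x * (1 - x)) ^ (2 * m + 1))),
    ← intervalIntegral.integral_ofReal]
  congr 1
  refine intervalIntegral.integral_congr fun x hx => ?_
  rw [Set.uIcc_of_le zero_le_one] at hx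
  have hx1 : 0 ≤ 1 - x := sub_nonneg.2 hx.2
  have e : ((m + 3 / 2 : ℝ) : ℂ) - 1 = ((m + 1 / 2 : ℝ) : ℂ) := by push_cast; ring
  have e1 : (1 : ℂ) - x = ((1 - x : ℝ) : ℂ) := by push_cast; ring
  rw [e, e1, ← Complex.ofReal_cpow hx.1, ← Complex.ofReal_cpow hx1, ← Complex.ofReal_mul,
    ← Real.mul_rpow hx.1 hx1, Real.sqrt_eq_rpow, ← Real.rpow_natCast, ← Real.rpow_mul
      (mul_nonneg hx.1 hx1)]
  congr 2
  push_cast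
  ring

/-- Legendre's duplication formula turns the Beta value into the stated constant. -/
lemma moment_constant_eq (m : ℕ) :
    2 ^ m * m.factorial * √(2 / Real.pi) *
        (∫ x in (0 : ℝ)..1, √((x * (1 - x)) ^ (2 * m + 1))) =
      Real.Gamma (((2 * m + 1 : ℕ) : ℝ) / 2 + 1) /
        ((2 : ℝ) ^ (((2 * m + 1 : ℕ) : ℝ) / 2) * (1 + ((2 * m + 1 : ℕ) : ℝ))) := by
  rw [integral_sqrt_pow_eq_beta, beta]
  have hdup := Real.Gamma_mul_Gamma_add_half ((m : ℝ) + 1)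
  rw [Real.Gamma_nat_eq_factorial, show (m : ℝ) + 1 + 1 / 2 = m + 3 / 2 by ring] at hdup
  have hG : Real.Gamma ((m : ℝ) + 3 / 2 + (m + 3 / 2)) =
      (2 * m + 2) * Real.Gamma (2 * ((m : ℝ) + 1)) := by
    rw [show (m : ℝ) + 3 / 2 + (m + 3 / 2) = 2 * ((m : ℝ) + 1) + 1 by ring,
      Real.Gamma_add_one (by positivity)]
    ring
  have hpos : 0 < Real.Gamma (2 * ((m : ℝ) + 1)) := Real.Gamma_pos_of_pos (by positivity)
  have hpow : (2 : ℝ) ^ (1 - 2 * ((m : ℝ) + 1)) = (2 * 2 ^ m * 2 ^ m)⁻¹ := by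
    rw [show 1 - 2 * ((m : ℝ) + 1) = -((1 + m + m : ℕ) : ℝ) by push_cast; ring,
      Real.rpow_neg zero_le_two, Real.rpow_natCast, pow_add, pow_add, pow_one]
  have hpow2 : (2 : ℝ) ^ (((2 * m + 1 : ℕ) : ℝ) / 2) = 2 ^ m * √2 := by
    rw [show ((2 * m + 1 : ℕ) : ℝ) / 2 = (m : ℝ) + 1 / 2 by push_cast; ring,
      Real.rpow_add two_pos, Real.rpow_natCast, Real.sqrt_eq_rpow]
  have harg : ((2 * m + 1 : ℕ) : ℝ) / 2 + 1 = m + 3 / 2 := by push_cast; ring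
  rw [hpow2, harg, hG, Real.sqrt_div zero_le_two]
  rw [hpow] at hdup
  set G := Real.Gamma ((m : ℝ) + 3 / 2)
  set H := Real.Gamma (2 * ((m : ℝ) + 1))
  have hpi : 0 < √Real.pi := Real.sqrt_pos.2 Real.pi_pos
  have h2 : √2 * √2 = (2 : ℝ) := Real.mul_self_sqrt zero_le_two
  have h20 : (0 : ℝ) < √2 := by positivity
  have hm : ((2 * m + 1 : ℕ) : ℝ) = 2 * m + 1 := by push_cast; ring
  rw [hm]
  have hdup' : (m.factorial : ℝ) * G * (2 * 2 ^ m * 2 ^ m) = H * √Real.pi := by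
    rw [hdup]; field_simp
  rw [← mul_div_assoc, div_eq_div_iff (by positivity) (by positivity)]
  field_simp
  linear_combination (2 * G * (m + 1)) * (m.factorial * G * 2 ^ m * 2 ^ m) * h2 +
    2 * G * (m + 1) * hdup'

/-! ### The counting function of a sample -/

/-- The number of sample points `U j ω` in `(-∞, x]`. -/
noncomputable def sampleCount {Ω : Type*} {n : ℕ} (U : Fin n → Ω → ℝ) (x : ℝ) (ω : Ω) : ℕ :=
  (Finset.univ.filter fun j => U j ω ≤ x).card

lemma sampleCount_le {Ω : Type*} {n : ℕ} (U : Fin n → Ω → ℝ) (x : ℝ) (ω : Ω) :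
    sampleCount U x ω ≤ n := by
  simpa [sampleCount] using
    Finset.card_filter_le (Finset.univ : Finset (Fin n)) (fun j => U j ω ≤ x)

lemma orderStat_mono {Ω : Type*} {n : ℕ} (U : Fin n → Ω → ℝ) (ω : Ω) :
    Monotone fun i => orderStat U i ω :=
  Tuple.monotone_sort fun j => U j ω

lemma sampleCount_eq_card_orderStat {Ω : Type*} {n : ℕ} (U : Fin n → Ω → ℝ) (x : ℝ) (ω : Ω) :
    sampleCount U x ω = (Finset.univ.filter fun i => orderStat U i ω ≤ x).card := by
  rw [sampleCount, Finset.card_filter, Finset.card_filter]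
  exact (Equiv.sum_comp (Tuple.sort fun j => U j ω) fun j => if U j ω ≤ x then 1 else 0).symm

lemma lt_sampleCount_iff {Ω : Type*} {n : ℕ} (U : Fin n → Ω → ℝ) (x : ℝ) (ω : Ω) (i : Fin n) :
    (i : ℕ) < sampleCount U x ω ↔ orderStat U i ω ≤ x := by
  rw [sampleCount_eq_card_orderStat]
  exact Tuple.lt_card_le_iff_apply_le_of_monotone (orderStat_mono U ω)

lemma measurable_sampleCount_prod {Ω : Type*} [MeasurableSpace Ω] {n : ℕ} {U : Fin n → Ω → ℝ}
    (hU : ∀ j, Measurable (U j)) :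
    Measurable fun p : Ω × ℝ => sampleCount U p.2 p.1 := by
  simp only [sampleCount, Finset.card_filter]
  refine Finset.measurable_sum _ fun j _ => Measurable.ite ?_ measurable_const measurable_const
  exact measurableSet_le ((hU j).comp measurable_fst) measurable_snd

lemma measurable_orderStat {Ω : Type*} [MeasurableSpace Ω] {n : ℕ} {U : Fin n → Ω → ℝ}
    (hU : ∀ j, Measurable (U j)) (i : Fin n) : Measurable (orderStat U i) := by
  refine measurable_of_Iic fun x => ?_
  have h : orderStat U i ⁻¹' Set.Iic x = (fun ω => sampleCount U x ω) ⁻¹' Set.Ioi (i : ℕ) := by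
    ext ω
    simp [lt_sampleCount_iff]
  rw [h]
  exact ((measurable_sampleCount_prod hU).comp (measurable_id.prodMk measurable_const))
    measurableSet_Ioi

/-! ### Distance to the identity: quantile function versus distribution function -/

lemma integral_abs_sub_pow (c : ℝ) (b : ℕ) (s t : ℝ) :
    ∫ x in s..t, |c - x| ^ b =
      (c - s) * |c - s| ^ b / (b + 1) - (c - t) * |c - t| ^ b / (b + 1) := by
  have hd : ∀ x : ℝ, HasDerivAt (fun x => -((c - x) * |c - x| ^ b / (b + 1))) (|c - x| ^ b) x := by
    intro x
    have h1 : HasDerivAt (fun x : ℝ => c - x) (-1) x := by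
      simpa using (hasDerivAt_id x).const_sub c
    have h2 := (((hasDerivAt_mul_abs_pow b (c - x)).comp x h1).div_const ((b : ℝ) + 1)).neg
    convert! h2 using 1
    field_simp
  rw [intervalIntegral.integral_eq_sub_of_hasDerivAt (fun x _ => hd x)
    (Continuous.intervalIntegrable (by fun_prop) _ _)]
  ring

/-- For `b ≥ 1` both sides are the integral of `b |x - u| ^ (b - 1)` over the region between the graph of the
empirical distribution function and the diagonal. Since every piece has an explicit primitive,
the identity reduces to a summation by parts. -/
lemma sum_integral_orderStat_eq {Ω : Type*} {n : ℕ} (hn : 1 ≤ n) (U : Fin n → Ω → ℝ) (ω : Ω)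
    (hU : ∀ j, U j ω ∈ Set.Icc (0 : ℝ) 1) (b : ℕ) :
    ∑ i : Fin n, ∫ u in ((i : ℕ) / n : ℝ)..(((i : ℕ) + 1 : ℕ) / n : ℝ), |orderStat U i ω - u| ^ b =
      ∫ x in (0 : ℝ)..1, |(sampleCount U x ω : ℝ) / n - x| ^ b := by
  have hn0 : (0 : ℝ) < n := by exact_mod_cast hn
  -- The order statistics, extended by the endpoints of the unit interval.
  let Y : ℕ → ℝ := fun k =>
    if k = 0 then 0 else if h : k - 1 < n then orderStat U ⟨k - 1, h⟩ ω else 1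
  have hY0 : Y 0 = 0 := by simp [Y]
  have hYn : Y (n + 1) = 1 := by simp [Y]
  have hYs : ∀ i : Fin n, Y (i + 1) = orderStat U i ω := fun i => by simp [Y]
  have hX : ∀ i, orderStat U i ω ∈ Set.Icc (0 : ℝ) 1 := fun i => hU _
  have hYmono : ∀ k < n + 1, Y k ≤ Y (k + 1) := by
    intro k hk
    rcases k with _ | k
    · rw [hY0, hYs ⟨0, hn⟩]; exact (hX _).1
    · have hk' : k < n := by omega
      rw [hYs ⟨k, hk'⟩]
      by_cases h : k + 1 < n
      · rw [hYs ⟨k + 1, h⟩]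
        exact orderStat_mono U ω (by simp)
      · rw [show k + 1 + 1 = n + 1 by omega, hYn]
        exact (hX _).2
  have hcount : ∀ k < n + 1, ∀ x, Y k < x → x < Y (k + 1) → sampleCount U x ω = k := by
    intro k hk x h1 h2
    refine le_antisymm ?_ ?_
    · rcases Nat.lt_or_ge k n with h | h
      · by_contra hlt
        rw [not_le, lt_sampleCount_iff U x ω ⟨k, h⟩, ← hYs ⟨k, h⟩] at hlt
        exact absurd h2 (not_lt.2 hlt)
      · exact (sampleCount_le U x ω).trans h
    · rcases k with _ | k
      · exact Nat.zero_le _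
      · have hk' : k < n := by omega
        exact (lt_sampleCount_iff U x ω ⟨k, hk'⟩).2 ((hYs ⟨k, hk'⟩).symm.le.trans h1.le)
  have hae : ∀ k < n + 1, ∀ᵐ x : ℝ, x ∈ Set.uIoc (Y k) (Y (k + 1)) →
      |(k : ℝ) / n - x| ^ b = |(sampleCount U x ω : ℝ) / n - x| ^ b := by
    intro k hk
    have hne : ∀ᵐ x : ℝ, x ≠ Y (k + 1) := by simp [ae_iff]
    filter_upwards [hne] with x hx hmem
    rw [Set.uIoc_of_le (hYmono k hk)] at hmem
    rw [hcount k hk x hmem.1 (lt_of_le_of_ne hmem.2 hx)]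
  have hint : ∀ k < n + 1, IntervalIntegrable
      (fun x => |(sampleCount U x ω : ℝ) / n - x| ^ b) volume (Y k) (Y (k + 1)) := by
    intro k hk
    have hc : IntervalIntegrable (fun x => |(k : ℝ) / n - x| ^ b) volume (Y k) (Y (k + 1)) :=
      Continuous.intervalIntegrable (by fun_prop) _ _
    exact hc.congr_ae ((ae_restrict_iff' measurableSet_uIoc).2 (hae k hk))
  have hright := intervalIntegral.sum_integral_adjacent_intervals hint
  rw [hY0, hYn] at hright
  rw [← hright]
  let g : ℝ → ℝ := fun y => y * |y| ^ b / (b + 1)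
  have hpiece : ∀ k ∈ Finset.range (n + 1),
      ∫ x in Y k..Y (k + 1), |(sampleCount U x ω : ℝ) / n - x| ^ b =
        g (k / n - Y k) - g (k / n - Y (k + 1)) := by
    intro k hk
    rw [← intervalIntegral.integral_congr_ae (hae k (Finset.mem_range.1 hk)),
      integral_abs_sub_pow]
  have hcell : ∀ i : Fin n,
      ∫ u in ((i : ℕ) / n : ℝ)..(((i : ℕ) + 1 : ℕ) / n : ℝ), |orderStat U i ω - u| ^ b =
        g ((i + 1 : ℕ) / n - Y (i + 1)) - g ((i : ℕ) / n - Y (i + 1)) := by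
    intro i
    rw [integral_abs_sub_pow, hYs i]
    simp only [g]
    rw [abs_sub_comm (orderStat U i ω), abs_sub_comm (orderStat U i ω)]
    ring
  rw [Finset.sum_congr rfl hpiece, Finset.sum_congr rfl fun i _ => hcell i,
    Fin.sum_univ_eq_sum_range fun k : ℕ => g ((k + 1 : ℕ) / n - Y (k + 1)) - g (k / n - Y (k + 1)),
    Finset.sum_sub_distrib, Finset.sum_sub_distrib,
    Finset.sum_range_succ' (fun k : ℕ => g (k / n - Y k)),
    Finset.sum_range_succ (fun k : ℕ => g (k / n - Y (k + 1))), hY0, hYn]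
  simp [g, hn0.ne']

/-! ### The counting function is binomial -/

lemma measure_preimage_Iic_Ioi {Ω : Type*} [MeasurableSpace Ω] {μ : Measure Ω} {X : Ω → ℝ}
    (hX : Measurable X) (hu : pdf.IsUniform X (Set.Icc (0 : ℝ) 1) μ volume) {x : ℝ}
    (hx : x ∈ Set.Icc (0 : ℝ) 1) :
    μ (X ⁻¹' Set.Iic x) = ENNReal.ofReal x ∧ μ (X ⁻¹' Set.Ioi x) = ENNReal.ofReal (1 - x) := by
  unfold pdf.IsUniform at hu
  constructor
  · rw [← Measure.map_apply hX measurableSet_Iic, hu, cond_apply measurableSet_Icc,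
      show Set.Icc (0 : ℝ) 1 ∩ Set.Iic x = Set.Icc 0 x by
        ext y; simp only [Set.mem_inter_iff, Set.mem_Icc, Set.mem_Iic]
        exact ⟨fun h => ⟨h.1.1, h.2⟩, fun h => ⟨⟨h.1, h.2.trans hx.2⟩, h.2⟩⟩]
    simp
  · rw [← Measure.map_apply hX measurableSet_Ioi, hu, cond_apply measurableSet_Icc,
      show Set.Icc (0 : ℝ) 1 ∩ Set.Ioi x = Set.Ioc x 1 by
        ext y; simp only [Set.mem_inter_iff, Set.mem_Icc, Set.mem_Ioi, Set.mem_Ioc]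
        exact ⟨fun h => ⟨h.2, h.1.2⟩, fun h => ⟨⟨hx.1.trans h.1.le, h.2⟩, h.1⟩⟩]
    simp

lemma ae_mem_Icc_of_isUniform {Ω : Type*} [MeasurableSpace Ω] {μ : Measure Ω} {X : Ω → ℝ}
    (hX : Measurable X) (hu : pdf.IsUniform X (Set.Icc (0 : ℝ) 1) μ volume) :
    ∀ᵐ ω ∂μ, X ω ∈ Set.Icc (0 : ℝ) 1 := by
  unfold pdf.IsUniform at hu
  refine ae_of_ae_map hX.aemeasurable ?_
  rw [hu]
  exact ae_cond_mem measurableSet_Icc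

lemma integral_sampleCount {Ω : Type*} [MeasurableSpace Ω] {μ : Measure Ω}
    [IsProbabilityMeasure μ] {n : ℕ} {U : Fin n → Ω → ℝ} (hU : ∀ j, Measurable (U j))
    (hind : iIndepFun U μ) (hu : ∀ j, pdf.IsUniform (U j) (Set.Icc (0 : ℝ) 1) μ volume)
    {x : ℝ} (hx : x ∈ Set.Icc (0 : ℝ) 1) (h : ℕ → ℝ) :
    ∫ ω, h (sampleCount U x ω) ∂μ =
      ∑ k ∈ Finset.range (n + 1), binomWeight n k x * h k := by
  let E : Finset (Fin n) → Set Ω := fun T =>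
    ⋂ j ∈ (Finset.univ : Finset (Fin n)), U j ⁻¹' (if j ∈ T then Set.Iic x else Set.Ioi x)
  have hEm : ∀ T, MeasurableSet (E T) := fun T =>
    Finset.measurableSet_biInter _ fun j _ => hU j (by
      split_ifs
      exacts [measurableSet_Iic, measurableSet_Ioi])
  have hEmem : ∀ T ω, ω ∈ E T ↔ (Finset.univ.filter fun j => U j ω ≤ x) = T := by
    intro T ω
    simp only [E, Set.mem_iInter, Finset.mem_univ, true_imp_iff, Set.mem_preimage,
      Finset.ext_iff, Finset.mem_filter, true_and]
    refine forall_congr' fun j => ?_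
    by_cases hj : j ∈ T <;> simp [hj]
  have hEμ : ∀ T, μ.real (E T) = x ^ T.card * (1 - x) ^ (n - T.card) := by
    intro T
    have h1 : μ (E T) = ∏ j : Fin n, μ (U j ⁻¹' (if j ∈ T then Set.Iic x else Set.Ioi x)) :=
      hind.measure_inter_preimage_eq_mul Finset.univ fun j _ => by
        split_ifs
        exacts [measurableSet_Iic, measurableSet_Ioi]
    have h2 : ∀ j, μ (U j ⁻¹' (if j ∈ T then Set.Iic x else Set.Ioi x)) =
        ENNReal.ofReal (if j ∈ T then x else 1 - x) := fun j => by
      have := measure_preimage_Iic_Ioi (hU j) (hu j) hx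
      split_ifs
      exacts [this.1, this.2]
    have h3 : ∀ j ∈ (Finset.univ : Finset (Fin n)), 0 ≤ if j ∈ T then x else 1 - x := fun j _ => by
      split_ifs
      exacts [hx.1, sub_nonneg.2 hx.2]
    rw [measureReal_def, h1, Finset.prod_congr rfl fun j _ => h2 j,
      ← ENNReal.ofReal_prod_of_nonneg h3, ENNReal.toReal_ofReal (Finset.prod_nonneg h3),
      Finset.prod_ite, Finset.prod_const, Finset.prod_const]
    have h4 : (Finset.univ.filter fun j => j ∈ T) = T := by ext; simp
    have h5 : (Finset.univ.filter fun j => j ∉ T).card = n - T.card := by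
      rw [show (Finset.univ.filter fun j => j ∉ T) = Tᶜ by ext; simp, Finset.card_compl,
        Fintype.card_fin]
    rw [h4, h5]
  have hpt : ∀ ω, h (sampleCount U x ω) =
      ∑ T : Finset (Fin n), (E T).indicator (fun _ => h T.card) ω := by
    intro ω
    rw [Finset.sum_eq_single (Finset.univ.filter fun j => U j ω ≤ x)]
    · rw [Set.indicator_of_mem ((hEmem _ _).2 rfl), sampleCount]
    · intro T _ hT
      exact Set.indicator_of_notMem (fun hm => hT ((hEmem _ _).1 hm).symm) _
    · simp
  simp only [hpt]
  rw [integral_finsetSum _ fun T _ => (integrable_const _).indicator (hEm T)]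
  simp only [integral_indicator_const _ (hEm _), hEμ, smul_eq_mul]
  have hs := Finset.sum_powerset_apply_card
    (fun k => x ^ k * (1 - x) ^ (n - k) * h k) (x := (Finset.univ : Finset (Fin n)))
  rw [Finset.powerset_univ, Finset.card_univ, Fintype.card_fin] at hs
  rw [hs]
  refine Finset.sum_congr rfl fun k _ => ?_
  rw [nsmul_eq_mul, binomWeight]
  ring

lemma abs_count_div_sub_le_one {Ω : Type*} {n : ℕ} (U : Fin n → Ω → ℝ) (ω : Ω)
    {x : ℝ} (hx : x ∈ Set.Icc (0 : ℝ) 1) : |(sampleCount U x ω : ℝ) / n - x| ≤ 1 := by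
  have h1 : (sampleCount U x ω : ℝ) / n ≤ 1 :=
    div_le_one_of_le₀ (by exact_mod_cast sampleCount_le U x ω) (by positivity)
  have h0 : 0 ≤ (sampleCount U x ω : ℝ) / n := by positivity
  exact abs_le.2 ⟨by linarith [hx.2], by linarith [hx.1]⟩

/-- The expected `b`-th power distance of the empirical distribution function to the identity. -/
lemma integral_integral_sampleCount {Ω : Type*} [MeasurableSpace Ω] {μ : Measure Ω}
    [IsProbabilityMeasure μ] {n : ℕ} (hn : 1 ≤ n) {U : Fin n → Ω → ℝ}
    (hU : ∀ j, Measurable (U j)) (hind : iIndepFun U μ)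
    (hu : ∀ j, pdf.IsUniform (U j) (Set.Icc (0 : ℝ) 1) μ volume) (b : ℕ) :
    Integrable (fun ω => ∫ x in (0 : ℝ)..1, |(sampleCount U x ω : ℝ) / n - x| ^ b) μ ∧
    ∫ ω, (∫ x in (0 : ℝ)..1, |(sampleCount U x ω : ℝ) / n - x| ^ b) ∂μ =
      absMoment n b 0 / (n : ℝ) ^ b := by
  have hn0 : (0 : ℝ) < n := by exact_mod_cast hn
  have hmeas : Measurable fun p : Ω × ℝ => |(sampleCount U p.2 p.1 : ℝ) / n - p.2| ^ b := by
    have h := measurable_sampleCount_prod hU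
    have h' : Measurable fun p : Ω × ℝ => (sampleCount U p.2 p.1 : ℝ) :=
      measurable_from_top.comp h
    fun_prop
  have hint : Integrable (fun p : Ω × ℝ => |(sampleCount U p.2 p.1 : ℝ) / n - p.2| ^ b)
      (μ.prod (volume.restrict (Set.Ioc (0 : ℝ) 1))) := by
    refine Integrable.of_bound hmeas.aestronglyMeasurable 1 ?_
    have hmem : ∀ᵐ p : Ω × ℝ ∂(μ.prod (volume.restrict (Set.Ioc (0 : ℝ) 1))),
        p.2 ∈ Set.Ioc (0 : ℝ) 1 :=
      Measure.quasiMeasurePreserving_snd.ae (ae_restrict_mem measurableSet_Ioc)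
    filter_upwards [hmem] with p hp
    rw [norm_pow, norm_abs_eq_norm, Real.norm_eq_abs]
    exact pow_le_one₀ (abs_nonneg _) (abs_count_div_sub_le_one U p.1 ⟨hp.1.le, hp.2⟩)
  simp only [intervalIntegral.integral_of_le zero_le_one]
  refine ⟨hint.integral_prod_left, ?_⟩
  rw [integral_integral_swap hint, ← intervalIntegral.integral_of_le zero_le_one]
  have hinner : ∀ x ∈ Set.uIcc (0 : ℝ) 1, ∫ ω, |(sampleCount U x ω : ℝ) / n - x| ^ b ∂μ =
      ∑ k ∈ Finset.range (n + 1),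
        ((x * (1 - x)) ^ 0 * binomWeight n k x * |(k : ℝ) - n * x| ^ b) / (n : ℝ) ^ b := by
    intro x hx
    rw [Set.uIcc_of_le zero_le_one] at hx
    rw [integral_sampleCount hU hind hu hx fun k => |(k : ℝ) / n - x| ^ b]
    refine Finset.sum_congr rfl fun k _ => ?_
    rw [show (k : ℝ) / n - x = (k - n * x) / n by field_simp, abs_div, div_pow,
      abs_of_pos hn0]
    ring
  have hc := continuous_binomWeight n
  rw [intervalIntegral.integral_congr hinner, intervalIntegral.integral_finsetSum
    fun k _ => Continuous.intervalIntegrable (by fun_prop) _ _, absMoment, Finset.sum_div]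
  simp only [intervalIntegral.integral_div]

/-! ### Replacing the cells of the unit interval by their midpoints -/

lemma anchor_eq (n : ℕ) (i : Fin n) : anchor n i = (i : ℕ) / n + 1 / (2 * n) := by
  have hn0 : (0 : ℝ) < n := by exact_mod_cast i.pos
  unfold anchor
  push_cast
  field_simp
  ring

/-- Averaging `|X - u| ^ a` over the cell around an anchor changes it by the cell width times a
power one lower. -/
lemma abs_pow_sub_anchor_sub_integral_le {n : ℕ} (i : Fin n) (m : ℕ) (X : ℝ) :
    |(|X - anchor n i| ^ (2 * m + 1)) -
      n * ∫ u in ((i : ℕ) / n : ℝ)..(((i : ℕ) + 1 : ℕ) / n : ℝ), |X - u| ^ (2 * m + 1)| ≤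
      (2 * m + 1) * 4 ^ m * ((∫ u in ((i : ℕ) / n : ℝ)..(((i : ℕ) + 1 : ℕ) / n : ℝ),
        |X - u| ^ (2 * m)) + 1 / n * (1 / n) ^ (2 * m)) := by
  have hn0 : (0 : ℝ) < n := by exact_mod_cast i.pos
  set t := anchor n i with ht
  set l : ℝ := (i : ℕ) / n with hl
  set r : ℝ := ((i : ℕ) + 1 : ℕ) / n with hr
  have hlen : r - l = 1 / n := by rw [hr, hl]; push_cast; ring
  have hpos : (0 : ℝ) < 1 / n := by positivity
  have htl : t = l + 1 / (2 * n) := anchor_eq n i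
  have hhalf : 1 / (2 * n : ℝ) = 1 / n / 2 := by field_simp
  have hlr : l ≤ r := by linarith
  have hpt : ∀ u ∈ Set.Ioc l r, ‖|X - t| ^ (2 * m + 1) - |X - u| ^ (2 * m + 1)‖ ≤
      1 / n * ((2 * m + 1) * 4 ^ m) * (|X - u| ^ (2 * m) + (1 / n) ^ (2 * m)) := by
    intro u hu
    have htu : |t - u| ≤ 1 / n := abs_le.2 ⟨by linarith [hu.2], by linarith [hu.1]⟩
    have h1 : abs (|X - t| - |X - u|) ≤ 1 / n := by
      refine (abs_abs_sub_abs_le_abs_sub _ _).trans ?_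
      rw [show X - t - (X - u) = -(t - u) by ring, abs_neg]
      exact htu
    have h2 : max (abs |X - t|) (abs |X - u|) ≤ |X - u| + 1 / n := by
      rw [abs_abs, abs_abs]
      exact max_le (by linarith [(abs_le.1 h1).2]) (by linarith)
    have h3 : (|X - u| + 1 / n) ^ (2 * m) ≤ 4 ^ m * (|X - u| ^ (2 * m) + (1 / n) ^ (2 * m)) := by
      refine (add_pow_le (abs_nonneg _) hpos.le _).trans ?_
      have : (2 : ℝ) ^ (2 * m - 1) ≤ 4 ^ m := by
        rw [show (4 : ℝ) = 2 ^ 2 by norm_num, ← pow_mul]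
        exact pow_le_pow_right₀ one_le_two (Nat.sub_le _ _)
      gcongr
    rw [Real.norm_eq_abs]
    refine (abs_pow_sub_pow_le ..).trans ?_
    rw [Nat.add_sub_cancel]
    push_cast
    calc _ ≤ 1 / n * (2 * m + 1) * (|X - u| + 1 / n) ^ (2 * m) := by gcongr
      _ ≤ 1 / n * (2 * m + 1) * (4 ^ m * (|X - u| ^ (2 * m) + (1 / n) ^ (2 * m))) := by gcongr
      _ = _ := by ring
  have hc : ∀ b : ℕ, IntervalIntegrable (fun u => |X - u| ^ b) volume l r :=
    fun b => Continuous.intervalIntegrable (by fun_prop) _ _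
  have h := intervalIntegral.norm_integral_le_of_norm_le (μ := volume) hlr
    (Filter.Eventually.of_forall hpt) (Continuous.intervalIntegrable (by fun_prop) _ _)
  rw [intervalIntegral.integral_sub (by simp) (hc _), intervalIntegral.integral_const,
    intervalIntegral.integral_const_mul, intervalIntegral.integral_add (hc _) (by simp),
    intervalIntegral.integral_const, hlen, smul_eq_mul, smul_eq_mul, Real.norm_eq_abs] at h
  have e : |X - t| ^ (2 * m + 1) - n * ∫ u in l..r, |X - u| ^ (2 * m + 1) =
      n * (1 / n * |X - t| ^ (2 * m + 1) - ∫ u in l..r, |X - u| ^ (2 * m + 1)) := by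
    field_simp
  rw [e, abs_mul, abs_of_pos hn0]
  refine (mul_le_mul_of_nonneg_left h hn0.le).trans_eq ?_
  field_simp

lemma abs_sum_pow_sub_anchor_sub_le {Ω : Type*} {n : ℕ} (hn : 1 ≤ n) (U : Fin n → Ω → ℝ) (ω : Ω)
    (hU : ∀ j, U j ω ∈ Set.Icc (0 : ℝ) 1) (m : ℕ) :
    |(∑ i : Fin n, |orderStat U i ω - anchor n i| ^ (2 * m + 1)) -
      n * ∫ x in (0 : ℝ)..1, |(sampleCount U x ω : ℝ) / n - x| ^ (2 * m + 1)| ≤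
      (2 * m + 1) * 4 ^ m * ((∫ x in (0 : ℝ)..1, |(sampleCount U x ω : ℝ) / n - x| ^ (2 * m)) +
        (1 / n) ^ (2 * m)) := by
  have hn0 : (0 : ℝ) < n := by exact_mod_cast hn
  rw [← sum_integral_orderStat_eq hn U ω hU, ← sum_integral_orderStat_eq hn U ω hU,
    Finset.mul_sum, ← Finset.sum_sub_distrib]
  refine (Finset.abs_sum_le_sum_abs _ _).trans ((Finset.sum_le_sum fun i _ =>
    abs_pow_sub_anchor_sub_integral_le i m _).trans ?_)
  rw [← Finset.mul_sum, Finset.sum_add_distrib, Finset.sum_const, Finset.card_univ,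
    Fintype.card_fin, nsmul_eq_mul, ← mul_assoc (n : ℝ), mul_one_div_cancel hn0.ne', one_mul]

lemma integrable_abs_orderStat_sub_anchor_pow {Ω : Type*} [MeasurableSpace Ω] {μ : Measure Ω}
    [IsProbabilityMeasure μ] {n : ℕ} {U : Fin n → Ω → ℝ} (hU : ∀ j, Measurable (U j))
    (hmem : ∀ᵐ ω ∂μ, ∀ j, U j ω ∈ Set.Icc (0 : ℝ) 1) (a : ℕ) (i : Fin n) :
    Integrable (fun ω => |orderStat U i ω - anchor n i| ^ a) μ := by
  have hm := measurable_orderStat hU i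
  have hn0 : (0 : ℝ) < n := by exact_mod_cast i.pos
  refine Integrable.of_bound (C := 1)
    (Measurable.aestronglyMeasurable (by fun_prop)) ?_
  filter_upwards [hmem] with ω hω
  have h1 : orderStat U i ω ∈ Set.Icc (0 : ℝ) 1 := hω _
  have h2 : 0 ≤ anchor n i := by rw [anchor_eq]; positivity
  have h3 : anchor n i ≤ 1 := by
    have : ((i : ℕ) + 1 : ℕ) / (n : ℝ) ≤ 1 := (div_le_one hn0).2 (by exact_mod_cast i.2)
    have h4 : (0 : ℝ) ≤ 1 / (2 * n) := by positivity
    unfold anchor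
    linarith
  rw [norm_pow, norm_abs_eq_norm, Real.norm_eq_abs]
  exact pow_le_one₀ (abs_nonneg _) (abs_le.2 ⟨by linarith [h1.1], by linarith [h1.2]⟩)

lemma abs_sum_integral_sub_absMoment_le {Ω : Type*} [MeasurableSpace Ω] {μ : Measure Ω}
    [IsProbabilityMeasure μ] {n : ℕ} (hn : 1 ≤ n) {U : Fin n → Ω → ℝ}
    (hU : ∀ j, Measurable (U j)) (hind : iIndepFun U μ)
    (hu : ∀ j, pdf.IsUniform (U j) (Set.Icc (0 : ℝ) 1) μ volume) (m : ℕ) :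
    |(∑ i : Fin n, ∫ ω, |orderStat U i ω - anchor n i| ^ (2 * m + 1) ∂μ) -
      n * (absMoment n (2 * m + 1) 0 / (n : ℝ) ^ (2 * m + 1))| ≤
      (2 * m + 1) * 4 ^ m * (absMoment n (2 * m) 0 / (n : ℝ) ^ (2 * m) + (1 / n) ^ (2 * m)) := by
  have hmem : ∀ᵐ ω ∂μ, ∀ j, U j ω ∈ Set.Icc (0 : ℝ) 1 :=
    ae_all_iff.2 fun j => ae_mem_Icc_of_isUniform (hU j) (hu j)
  have hd := integrable_abs_orderStat_sub_anchor_pow (μ := μ) hU hmem (2 * m + 1)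
  obtain ⟨i1, e1⟩ := integral_integral_sampleCount hn hU hind hu (2 * m + 1)
  obtain ⟨i0, e0⟩ := integral_integral_sampleCount hn hU hind hu (2 * m)
  rw [← e1, ← e0, ← integral_finsetSum _ fun i _ => hd i, ← integral_const_mul,
    ← integral_sub (integrable_finsetSum _ fun i _ => hd i) (i1.const_mul _)]
  have hbound := (i0.add (integrable_const ((1 / n : ℝ) ^ (2 * m)))).const_mul
    ((2 * m + 1) * 4 ^ m : ℝ)
  rw [← Real.norm_eq_abs]
  refine (norm_integral_le_of_norm_le hbound
    (hmem.mono fun ω hω => abs_sum_pow_sub_anchor_sub_le hn U ω hω m)).trans_eq ?_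
  rw [integral_const_mul]
  congr 1
  simp only [Pi.add_apply]
  rw [integral_add i0 (integrable_const _), integral_const]
  simp

/-! ### The asymptotic formula -/

theorem theorem2 (a : ℕ) (ha : Odd a) :
    ∃ C : ℝ, ∀ (n : ℕ), 1 ≤ n →
      ∀ (Ω : Type*) [MeasurableSpace Ω] (μ : Measure Ω) [IsProbabilityMeasure μ]
        (U : Fin n → Ω → ℝ),
        (∀ j, Measurable (U j)) →
        iIndepFun U μ →
        (∀ j, pdf.IsUniform (U j) (Set.Icc (0 : ℝ) 1) μ volume) →
        (∀ i : Fin n, Integrable (fun ω => |orderStat U i ω - anchor n i| ^ a) μ) ∧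
        |(∑ i : Fin n, ∫ ω, |orderStat U i ω - anchor n i| ^ a ∂μ) -
            Real.Gamma ((a : ℝ) / 2 + 1) / ((2 : ℝ) ^ ((a : ℝ) / 2) * (1 + (a : ℝ))) *
              (1 / (n : ℝ) ^ ((a : ℝ) / 2 - 1))| ≤
          C * (1 / (n : ℝ) ^ (((a : ℝ) - 1) / 2)) := by
  obtain ⟨m, rfl⟩ := ha
  obtain ⟨C₁, -, h₁⟩ := exists_absMoment_even_le m
  obtain ⟨C₂, h₂⟩ := exists_absMoment_odd_sub_le m 0
  rw [add_zero, moment_constant_eq] at h₂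
  refine ⟨(2 * m + 1) * 4 ^ m * (C₁ + 1) + C₂, fun n hn Ω _ μ _ U hU hind hu => ⟨?_, ?_⟩⟩
  · exact integrable_abs_orderStat_sub_anchor_pow hU
      (ae_all_iff.2 fun j => ae_mem_Icc_of_isUniform (hU j) (hu j)) _
  have hn1 : (1 : ℝ) ≤ n := by exact_mod_cast hn
  have hn0 : (0 : ℝ) < n := by linarith
  have hk := abs_sum_integral_sub_absMoment_le hn hU hind hu m
  have h1 := h₁ n hn
  have h2 := h₂ n hn
  set c := Real.Gamma (((2 * m + 1 : ℕ) : ℝ) / 2 + 1) /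
    ((2 : ℝ) ^ (((2 * m + 1 : ℕ) : ℝ) / 2) * (1 + ((2 * m + 1 : ℕ) : ℝ)))
  have hp1 : 1 / (n : ℝ) ^ ((((2 * m + 1 : ℕ) : ℝ) - 1) / 2) = 1 / n ^ m := by
    rw [show (((2 * m + 1 : ℕ) : ℝ) - 1) / 2 = m by push_cast; ring, Real.rpow_natCast]
  have hp2 : 1 / (n : ℝ) ^ (((2 * m + 1 : ℕ) : ℝ) / 2 - 1) = √n / n ^ m := by
    rw [show ((2 * m + 1 : ℕ) : ℝ) / 2 - 1 = m - 1 / 2 by push_cast; ring,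
      Real.rpow_sub hn0, Real.rpow_natCast, ← Real.sqrt_eq_rpow, one_div_div]
  rw [hp1, hp2, add_mul]
  refine (abs_sub_le _ _ _).trans (add_le_add (hk.trans ?_) ?_)
  · rw [mul_assoc ((2 * (m : ℝ) + 1) * 4 ^ m)]
    refine mul_le_mul_of_nonneg_left ?_ (by positivity)
    rw [add_mul]
    refine add_le_add ?_ ?_
    · rw [div_le_iff₀ (by positivity)]
      refine h1.trans_eq ?_
      rw [two_mul, pow_add]
      field_simp
    · rw [one_div_pow, one_mul]
      exact one_div_le_one_div_of_le (by positivity) (pow_le_pow_right₀ hn1 (by omega))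
  · have e : n * (absMoment n (2 * m + 1) 0 / (n : ℝ) ^ (2 * m + 1)) - c * (√n / n ^ m) =
        (absMoment n (2 * m + 1) 0 - c * (n ^ m * √n)) / n ^ (2 * m) := by
      rw [pow_succ, two_mul, pow_add]
      field_simp
    rw [e, abs_div, abs_of_pos (by positivity : (0 : ℝ) < n ^ (2 * m)),
      div_le_iff₀ (by positivity)]
    refine h2.trans_eq ?_
    rw [two_mul, pow_add]
    field_simp
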